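/- Let $X$ be a real Banach space, $T>0$, $\alpha\ge 0$, $I=[0,T]$, $x_0\in X$, and let $U\subset\mathbb R^m$ be nonempty, compact and convex. Let $A\colon D(A)\subset X\to X$ be the generator of a $C_0$ semigroup $(S_t)_{t\ge0}$ on $X$, and let $f\colon I\times X\to X$, $G\colon I\times X\to\mathcal L(\mathbb R^m;X)$ and $\ell\colon X\to\mathbb R$. Call a map $\varphi\colon I\times X\to Y$ into a Banach space $Y$ a Lipschitz field if $t\mapsto\varphi_t(\mathrm x)$ is strongly (Bochner) measurable for every $\mathrm x\in X$ and there is a constant $M\ge0$ such that, for a.e. $t\in I$, $\|\varphi_t(\mathrm x)-\varphi_t(\mathrm y)\|_Y\le M\|\mathrm x-\mathrm y\|_X$ for all $\mathrm x,\mathrm y\in X$, and $\|\varphi_t(0)\|_Y\le M$. Assume: (A) $f$ and $G$ are Lipschitz fields; (B) $\ell$ is lower semicontinuous; (C) there are Lipschitz fields $g^1,\dots,g^m\colon I\times X\to\mathbb R^m$ and vectors $h^1,\dots,h^m\in X$ such that $G_t(\mathrm x)\mathrm u=\sum_{j=1}^m\bigl(\mathrm u^{T}g^j_t(\mathrm x)\bigr)h^j$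 for all $t\in I$, $\mathrm x\in X$, $\mathrm u\in\mathbb R^m$. Let $\mathcal U=L^\infty(I;U)$ be the set of $u\in L^\infty(I;\mathbb R^m)$ with $u(t)\in U$ for a.e. $t\in I$. Then for every $u\in\mathcal U$ there is a unique mild solution of $\dot x_t=Ax_t+f_t(x_t)+G_t(x_t)u(t)$ with initial value $x_0$, that is, a unique $x^u\in C(I;X)$ with $$x^u_t=S_tx_0+\int_0^tS_{t-\tau}\bigl(f_\tau(x^u_\tau)+G_\tau(x^u_\tau)u(\tau)\bigr)\,d\tau\qquad(t\in I),$$ and the problem $$(\mathbf P)\qquad\inf\Bigl\{\mathcal I[u]=\ell(x^u_T)+\frac{\alpha}{2}\int_I|u(t)|^2\,dt:\ u\in\mathcal U\Bigr\}$$ has a minimizer: there is $u^*\in\mathcal U$ with $\mathcal I[u^*]\le\mathcal I[u]$ for all $u\in\mathcal U$. -/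

import Mathlib

open MeasureTheory Set Filter Topology
open scoped NNReal ENNReal RealInnerProductSpace

namespace OptimalControl

/-- A strongly continuous (`C₀`) semigroup of bounded linear operators. -/
structure IsC0Semigroup {X : Type*} [NormedAddCommGroup X] [NormedSpace ℝ X]
    (S : ℝ≥0 → X →L[ℝ] X) : Prop where
  map_zero : S 0 = ContinuousLinearMap.id ℝ X
  map_add : ∀ t τ : ℝ≥0, S (t + τ) = (S t).comp (S τ)
  continuous_orbit : ∀ x : X, Continuous fun t : ℝ≥0 => S t x

/-- The (partially defined) linear operator `A` is the infinitesimal generator of `S`: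
`x ∈ D(A)` and `A x = y` if and only if `(S_h x - x) / h → y` as `h → 0+`. -/
def IsGenerator {X : Type*} [NormedAddCommGroup X] [NormedSpace ℝ X]
    (A : X →ₗ.[ℝ] X) (S : ℝ≥0 → X →L[ℝ] X) : Prop :=
  ∀ x y : X, (∃ hx : x ∈ A.domain, A ⟨x, hx⟩ = y) ↔
    Tendsto (fun h : ℝ≥0 => (h : ℝ)⁻¹ • (S h x - x)) (𝓝[>] 0) (𝓝 y)

/-- `t ↦ φ_t(x)` is strongly (Bochner) measurable on `[0,T]` for every `x`, and for some constant
`M ≥ 0` and a.e. `t ∈ [0,T]` the map `φ_t` is `M`-Lipschitz with `‖φ_t(0)‖ ≤ M`. -/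
structure IsLipschitzField {X Y : Type*} [NormedAddCommGroup X] [NormedAddCommGroup Y]
    (T : ℝ) (φ : ℝ → X → Y) : Prop where
  aestronglyMeasurable : ∀ x : X,
    AEStronglyMeasurable (fun t => φ t x) (volume.restrict (Icc 0 T))
  exists_bound : ∃ M : ℝ, 0 ≤ M ∧ ∀ᵐ t ∂(volume.restrict (Icc 0 T)),
    (∀ x y : X, ‖φ t x - φ t y‖ ≤ M * ‖x - y‖) ∧ ‖φ t 0‖ ≤ M

/-- The finite-channel structure `G_t(x) u = ∑ j, (uᵀ g^j_t(x)) h^j` on `[0,T]`. -/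
structure HasFiniteChannels {X : Type*} [NormedAddCommGroup X] [NormedSpace ℝ X] {m : ℕ}
    (T : ℝ) (G : ℝ → X → EuclideanSpace ℝ (Fin m) →L[ℝ] X)
    (g : Fin m → ℝ → X → EuclideanSpace ℝ (Fin m)) (h : Fin m → X) : Prop where
  isLipschitzField : ∀ j, IsLipschitzField T (g j)
  apply_eq : ∀ t ∈ Icc 0 T, ∀ (x : X) (u : EuclideanSpace ℝ (Fin m)),
    G t x u = ∑ j, ⟪u, g j t x⟫ • h j

/-- The admissible controls `L^∞([0,T];U)`, a subset of `L^∞([0,T];ℝ^m)`. -/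
def admissibleControls {m : ℕ} (T : ℝ) (U : Set (EuclideanSpace ℝ (Fin m))) :
    Set (Lp (EuclideanSpace ℝ (Fin m)) ∞ (volume.restrict (Icc 0 T))) :=
  {u | ∀ᵐ t ∂(volume.restrict (Icc 0 T)), u t ∈ U}

/-- `x` is, on `[0,T]`, a mild solution of `x' = A x + f_t(x) + G_t(x) u(t)`, `x(0) = x₀`, where
`S` is the semigroup generated by `A`. Values of `x` outside `[0,T]` are irrelevant. -/
structure IsMildSolution {X : Type*} [NormedAddCommGroup X] [NormedSpace ℝ X] {m : ℕ}
    (T : ℝ) (S : ℝ≥0 → X →L[ℝ] X) (f : ℝ → X → X)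
    (G : ℝ → X → EuclideanSpace ℝ (Fin m) →L[ℝ] X) (x₀ : X)
    (u : ℝ → EuclideanSpace ℝ (Fin m)) (x : ℝ → X) : Prop where
  continuousOn : ContinuousOn x (Icc 0 T)
  intervalIntegrable : ∀ t ∈ Icc 0 T, IntervalIntegrable
    (fun τ => S (t - τ).toNNReal (f τ (x τ) + G τ (x τ) (u τ))) volume 0 t
  eq_integral : ∀ t ∈ Icc 0 T,
    x t = S t.toNNReal x₀ +
      ∫ τ in (0 : ℝ)..t, S (t - τ).toNNReal (f τ (x τ) + G τ (x τ) (u τ))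

/-- The cost `ℓ(x(T)) + (α/2) ∫_0^T |u(t)|² dt` of a control `u` with trajectory `x`. -/
noncomputable def cost {X : Type*} {m : ℕ} (T α : ℝ) (ℓ : X → ℝ)
    (u : ℝ → EuclideanSpace ℝ (Fin m)) (x : ℝ → X) : ℝ :=
  ℓ (x T) + α / 2 * ∫ t in Icc 0 T, ‖u t‖ ^ 2

end OptimalControl

/-! The proof is the direct method. A minimizing sequence of controls is bounded in L², so a
subsequence converges weakly; the limit is again `U`-valued because `U` is closed and convex
(`exists_subseq_tendsto_integral_inner`). The quadratic cost is weakly lower semicontinuous, and `ℓ`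
is only lower semicontinuous for the norm, so everything rests on norm convergence of the final
states, `tendsto_final_state`.

The semigroup is not assumed compact; the finite channels take the place of compactness. Let y be
the trajectory of the weak limit v. The Lipschitz bounds control x_n - y, up to a Grönwall term, by
z_n, the Duhamel integral of G(y)(u_n - v). This is evaluated along the fixed path y, not along x_n.
By the channel structure z_n(t) is a finite sum of integrals of ⟪u_n - v, g^j(y)⟫ S_{t-τ} h^j:
bounded scalars with vanishing set integrals, tested against a fixed integrable X-valued function.
Approximation by simple functions gives z_n(t) → 0 in norm for each t. Pointwise convergence with a
uniform bound is enough, because the integral form of Grönwall only needs an integral to vanish.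

Trajectories come from a Picard map with a contracting iterate. As `ℓ` need not be bounded below,
the minimizing sequence is taken in the extended reals; finiteness of the infimum is a consequence
of the theorem. -/

namespace OptimalControl

/-! ### Measurability and weak limits. -/

/-- Composition of a Carathéodory map with an almost everywhere strongly measurable map. -/
theorem aestronglyMeasurable_caratheodory {α X Y : Type*} [MeasurableSpace α] {μ : Measure α}
    [NormedAddCommGroup X] [NormedAddCommGroup Y] {F : α → X → Y}
    (hF : ∀ x, AEStronglyMeasurable (fun a => F a x) μ) (hc : ∀ᵐ a ∂μ, Continuous (F a))
    {x : α → X} (hx : AEStronglyMeasurable x μ) :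
    AEStronglyMeasurable (fun a => F a (x a)) μ := by
  have hsimple : ∀ s : SimpleFunc α X, AEStronglyMeasurable (fun a => F a (s a)) μ := by
    intro s
    have hsum : (fun a => F a (s a)) =
        fun a => ∑ y ∈ s.range, (s ⁻¹' {y}).indicator (fun a => F a y) a := by
      funext a
      rw [Finset.sum_eq_single (s a)]
      · simp
      · intro b _ hb
        simp [Ne.symm hb]
      · intro h
        exact absurd (s.mem_range_self a) h
    rw [hsum]
    refine Finset.aestronglyMeasurable_fun_sum _ fun y _ => ?_
    exact (hF y).indicator (s.measurableSet_fiber y)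
  have hmk : AEStronglyMeasurable (fun a => F a (hx.mk x a)) μ := by
    refine aestronglyMeasurable_of_tendsto_ae atTop
      (f := fun n a => F a (hx.stronglyMeasurable_mk.approx n a)) (fun n => hsimple _) ?_
    filter_upwards [hc] with a ha
    exact (ha.tendsto _).comp (hx.stronglyMeasurable_mk.tendsto_approx a)
  refine hmk.congr ?_
  filter_upwards [hx.ae_eq_mk] with a ha
  rw [ha]

/-- Bounded scalar functions whose integrals over all measurable sets tend to zero also tend to
zero when tested against integrable vector-valued functions. -/
theorem tendsto_integral_smul_of_tendsto_setIntegral {α X : Type*} [MeasurableSpace α]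
    {μ : Measure α} [IsFiniteMeasure μ] [NormedAddCommGroup X] [NormedSpace ℝ X] [CompleteSpace X]
    {a : ℕ → α → ℝ} {B : ℝ} (ha : ∀ n, AEStronglyMeasurable (a n) μ)
    (hB : ∀ n, ∀ᵐ t ∂μ, ‖a n t‖ ≤ B)
    (hlim : ∀ s, MeasurableSet s → Tendsto (fun n => ∫ t in s, a n t ∂μ) atTop (𝓝 0))
    {k : α → X} (hk : Integrable k μ) :
    Tendsto (fun n => ∫ t, a n t • k t ∂μ) atTop (𝓝 0) := by
  have hint : ∀ n {k : α → X}, Integrable k μ → Integrable (fun t => a n t • k t) μ :=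
    fun n k hk => hk.bdd_smul B (ha n) (hB n)
  refine Integrable.induction
    (P := fun k => Tendsto (fun n => ∫ t, a n t • k t ∂μ) atTop (𝓝 0)) ?_ ?_ ?_ ?_ hk
  · intro c s hs _
    have heq : ∀ n, ∫ t, a n t • s.indicator (fun _ => c) t ∂μ = (∫ t in s, a n t ∂μ) • c := by
      intro n
      rw [← integral_smul_const, ← integral_indicator hs]
      congr 1
      funext t
      by_cases ht : t ∈ s <;> simp [ht]
    simp only [heq]
    simpa using (hlim s hs).smul_const c
  · intro f g _ hf hg hPf hPg
    have heq : ∀ n, ∫ t, a n t • (f + g) t ∂μ = ∫ t, a n t • f t ∂μ + ∫ t, a n t • g t ∂μ := by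
      intro n
      rw [← integral_add (hint n hf) (hint n hg)]
      simp [smul_add]
    simp only [heq]
    simpa using hPf.add hPg
  -- The uniform bound `B` makes the functionals k ↦ ∫ a_n k equicontinuous in L¹, so convergence
  -- survives L¹ limits. The `+ 1` guards against `B = 0`.
  · refine isClosed_of_closure_subset fun f hf => ?_
    rw [mem_ofPred_eq, Metric.tendsto_atTop]
    intro ε hε
    obtain ⟨g, hg, hfg⟩ := Metric.mem_closure_iff.1 hf (ε / 2 / (|B| + 1)) (by positivity)
    obtain ⟨N, hN⟩ := Metric.tendsto_atTop.1 hg (ε / 2) (by positivity)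
    refine ⟨N, fun n hn => ?_⟩
    have h1 := hN n hn
    rw [dist_zero_right] at h1 ⊢
    have hf' := L1.integrable_coeFn f
    have hg' := L1.integrable_coeFn g
    have h2 : ‖∫ t, a n t • f t ∂μ - ∫ t, a n t • g t ∂μ‖ ≤ |B| * dist f g := by
      rw [← integral_sub (hint n hf') (hint n hg'), L1.dist_eq_integral_dist,
        ← integral_const_mul]
      refine norm_integral_le_of_norm_le ?_ ?_
      · simp only [dist_eq_norm]
        exact ((hf'.sub hg').norm.const_mul _)
      · filter_upwards [hB n] with t ht
        rw [← smul_sub, norm_smul, dist_eq_norm]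
        gcongr
        exact ht.trans (le_abs_self B)
    have h3 : |B| * dist f g < ε / 2 := by
      have h4 := (lt_div_iff₀ (by positivity)).1 hfg
      nlinarith [dist_nonneg (x := f) (y := g)]
    calc ‖∫ t, a n t • f t ∂μ‖
        ≤ ‖∫ t, a n t • f t ∂μ - ∫ t, a n t • g t ∂μ‖ + ‖∫ t, a n t • g t ∂μ‖ := by
          simpa using norm_add_le (∫ t, a n t • f t ∂μ - ∫ t, a n t • g t ∂μ)
            (∫ t, a n t • g t ∂μ)
      _ < ε := by linarith
  · intro f g hfg _ hf
    refine hf.congr fun n => integral_congr_ae ?_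
    filter_upwards [hfg] with t ht
    rw [ht]

/-- Weak sequential compactness of the square integrable functions with values in a compact
convex set. -/
theorem exists_subseq_tendsto_integral_inner {α E : Type*} [MeasurableSpace α] {μ : Measure α}
    [IsFiniteMeasure μ] [IsSeparable μ] [NormedAddCommGroup E] [InnerProductSpace ℝ E]
    [FiniteDimensional ℝ E] {U : Set E} (hU : IsCompact U) (hUc : Convex ℝ U)
    {u : ℕ → α → E} (hum : ∀ n, AEStronglyMeasurable (u n) μ) (huU : ∀ n, ∀ᵐ t ∂μ, u n t ∈ U) :
    ∃ v : α → E, AEStronglyMeasurable v μ ∧ (∀ᵐ t ∂μ, v t ∈ U) ∧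
      ∃ φ : ℕ → ℕ, StrictMono φ ∧ ∀ ψ : α → E, MemLp ψ 2 μ →
        Tendsto (fun n => ∫ t, ⟪ψ t, u (φ n) t⟫ ∂μ) atTop (𝓝 (∫ t, ⟪ψ t, v t⟫ ∂μ)) := by
  have : CompleteSpace E := FiniteDimensional.complete ℝ E
  have : TopologicalSpace.SeparableSpace E := by
    have := FiniteDimensional.proper ℝ E
    infer_instance
  obtain ⟨R, hR⟩ := hU.isBounded.exists_norm_le
  have huR : ∀ n, ∀ᵐ t ∂μ, ‖u n t‖ ≤ R := fun n => (huU n).mono fun t ht => hR _ ht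
  have huL : ∀ n, MemLp (u n) 2 μ := fun n => MemLp.of_bound (hum n) R (huR n)
  let w : ℕ → Lp E 2 μ := fun n => (huL n).toLp (u n)
  obtain ⟨C, hC⟩ : ∃ C, ∀ n, ‖w n‖ ≤ C := by
    refine ⟨_, fun n => Lp.norm_le_of_ae_bound (C := |R|) (abs_nonneg R) ?_⟩
    filter_upwards [(huL n).coeFn_toLp, huR n] with t h1 h2
    rw [h1]
    exact h2.trans (le_abs_self R)
  have hmem : ∀ n, StrongDual.toWeakDual (InnerProductSpace.toDual ℝ (Lp E 2 μ) (w n)) ∈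
      WeakDual.toStrongDual ⁻¹' Metric.closedBall (0 : StrongDual ℝ (Lp E 2 μ)) C := by
    intro n
    change dist (InnerProductSpace.toDual ℝ (Lp E 2 μ) (w n)) 0 ≤ C
    rw [dist_zero_right, LinearIsometryEquiv.norm_map]
    exact hC n
  have : Fact ((1 : ℝ≥0∞) ≤ 2) := ⟨one_le_two⟩
  have : Fact ((2 : ℝ≥0∞) ≠ ∞) := ⟨ENNReal.ofNat_ne_top⟩
  -- Sequential Banach–Alaoglu, available because L² of a separable measure is separable; Riesz then
  -- turns the limit functional into a function.
  obtain ⟨L, -, φ, hφ, hL⟩ := WeakDual.isSeqCompact_closedBall ℝ (Lp E 2 μ) 0 C hmem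
  let v : Lp E 2 μ := (InnerProductSpace.toDual ℝ (Lp E 2 μ)).symm (WeakDual.toStrongDual L)
  have hv : ∀ ψ : Lp E 2 μ, Tendsto (fun n => ⟪w (φ n), ψ⟫) atTop (𝓝 ⟪v, ψ⟫) := by
    intro ψ
    have h1 := ((WeakDual.eval_continuous ψ).tendsto L).comp hL
    have h2 : ⟪v, ψ⟫ = L ψ := by
      simp [v]
    rw [h2]
    exact h1
  have hinner : ∀ {f g : α → E} (hf : MemLp f 2 μ) (hg : MemLp g 2 μ),
      ⟪hf.toLp f, hg.toLp g⟫ = ∫ t, ⟪f t, g t⟫ ∂μ := by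
    intro f g hf hg
    rw [L2.inner_def]
    refine integral_congr_ae ?_
    filter_upwards [hf.coeFn_toLp, hg.coeFn_toLp] with t h1 h2
    rw [h1, h2]
  refine ⟨v, Lp.aestronglyMeasurable v, ?_, φ, hφ, ?_⟩
  -- Mazur's argument: `K` is convex and norm closed, so a limit outside it would be strictly
  -- separated from the sequence by a functional, against weak convergence.
  · let K : Set (Lp E 2 μ) := {f | ∀ᵐ t ∂μ, f t ∈ U}
    have hKc : Convex ℝ K := by
      intro f hf g hg a b ha hb hab
      change ∀ᵐ t ∂μ, _
      filter_upwards [hf, hg, Lp.coeFn_add (a • f) (b • g), Lp.coeFn_smul a f,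
        Lp.coeFn_smul b g] with t h1 h2 h3 h4 h5
      rw [h3, Pi.add_apply, h4, h5]
      exact hUc h1 h2 ha hb hab
    have hKcl : IsClosed K := by
      refine IsSeqClosed.isClosed fun f p hf hp => ?_
      obtain ⟨ns, -, hns⟩ := (tendstoInMeasure_of_tendsto_Lp hp).exists_seq_tendsto_ae
      have hall : ∀ᵐ t ∂μ, ∀ n, f n t ∈ U := ae_all_iff.2 hf
      change ∀ᵐ t ∂μ, _
      filter_upwards [hns, hall] with t h1 h2
      exact hU.isClosed.mem_of_tendsto h1 (Eventually.of_forall fun n => h2 _)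
    by_contra hvK
    obtain ⟨ℓ, c, h1, h2⟩ := geometric_hahn_banach_closed_point hKc hKcl (x := v) hvK
    let ψ := (InnerProductSpace.toDual ℝ (Lp E 2 μ)).symm ℓ
    have hψ : ∀ f, ⟪f, ψ⟫ = ℓ f := by
      intro f
      rw [real_inner_comm]
      simp [ψ]
    have h3 := hv ψ
    simp only [hψ] at h3
    refine absurd (le_of_tendsto h3 (Eventually.of_forall fun n => (h1 (w (φ n)) ?_).le)) (not_le.2 h2)
    change ∀ᵐ t ∂μ, _
    filter_upwards [(huL (φ n)).coeFn_toLp, huU (φ n)] with t h4 h5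
    rw [h4]
    exact h5
  · intro ψ hψ
    have h1 := hv (hψ.toLp ψ)
    have h2 : ⟪v, hψ.toLp ψ⟫ = ∫ t, ⟪ψ t, v t⟫ ∂μ := by
      have := hinner hψ (Lp.memLp v)
      rw [Lp.toLp_coeFn] at this
      rw [real_inner_comm, this]
    rw [h2] at h1
    refine h1.congr fun n => ?_
    rw [real_inner_comm, hinner hψ (huL (φ n))]

/-! ### Grönwall's inequality. -/

/-- Integral form of Grönwall's inequality. -/
theorem integral_le_exp_mul_integral {T C : ℝ} (hC : 0 ≤ C) {e r : ℝ → ℝ} (he : Continuous e)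
    (hr : Continuous r) (hr0 : ∀ t, 0 ≤ r t)
    (h : ∀ t ∈ Icc 0 T, e t ≤ r t + C * ∫ τ in (0 : ℝ)..t, e τ) {t : ℝ} (ht : t ∈ Icc 0 T) :
    ∫ τ in (0 : ℝ)..t, e τ ≤ Real.exp (C * t) * ∫ τ in (0 : ℝ)..t, r τ := by
  -- Integrating factor: F' = exp(-Ct)(e - C∫e) - r ≤ (exp(-Ct) - 1) r ≤ 0 on the open interval, and
  -- F(0) = 0.
  let F : ℝ → ℝ := fun t =>
    Real.exp (-(C * t)) * (∫ τ in (0 : ℝ)..t, e τ) - ∫ τ in (0 : ℝ)..t, r τ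
  have hF : ∀ t, HasDerivAt F (Real.exp (-(C * t)) * (-(C * 1)) * (∫ τ in (0 : ℝ)..t, e τ) +
      Real.exp (-(C * t)) * e t - r t) t := by
    intro t
    exact (((((hasDerivAt_id t).const_mul C).neg).exp).mul
      (he.integral_hasStrictDerivAt 0 t).hasDerivAt).sub
      (hr.integral_hasStrictDerivAt 0 t).hasDerivAt
  have hanti : AntitoneOn F (Icc 0 T) := by
    refine antitoneOn_of_deriv_nonpos (convex_Icc 0 T)
      (fun t _ => (hF t).continuousAt.continuousWithinAt)
      (fun t _ => (hF t).differentiableAt.differentiableWithinAt) fun t ht => ?_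
    rw [interior_Icc] at ht
    rw [(hF t).deriv]
    have h1 := h t (Ioo_subset_Icc_self ht)
    have h2 : Real.exp (-(C * t)) ≤ 1 := by
      rw [Real.exp_le_one_iff]
      nlinarith [ht.1]
    have h3 := mul_le_mul_of_nonneg_left h1 (Real.exp_pos (-(C * t))).le
    have h4 := mul_le_mul_of_nonneg_right h2 (hr0 t)
    linarith
  have h1 := hanti (left_mem_Icc.2 (ht.1.trans ht.2)) ht ht.1
  have h2 : F 0 = 0 := by simp [F]
  rw [h2] at h1
  have h3 : Real.exp (-(C * t)) * (∫ τ in (0 : ℝ)..t, e τ) ≤ ∫ τ in (0 : ℝ)..t, r τ := by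
    simpa [F] using h1
  have h4 := mul_le_mul_of_nonneg_left h3 (Real.exp_pos (C * t)).le
  rwa [← mul_assoc, ← Real.exp_add, add_neg_cancel, Real.exp_zero, one_mul] at h4

/-! ### Semigroup bounds and the Duhamel convolution. -/

section Semigroup

variable {X : Type*} [NormedAddCommGroup X] [NormedSpace ℝ X] {S : ℝ≥0 → X →L[ℝ] X}

/-- Orbits are continuous, hence bounded on a compact interval; Banach–Steinhaus makes the bound
uniform. -/
theorem IsC0Semigroup.exists_norm_le [CompleteSpace X] (hS : IsC0Semigroup S) (T : ℝ) :
    ∃ M, 0 < M ∧ ∀ t ∈ Icc 0 T, ‖S t.toNNReal‖ ≤ M := by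
  have hb : ∀ x, ∃ C, ∀ i : Icc (0 : ℝ) T, ‖S (i : ℝ).toNNReal x‖ ≤ C := by
    intro x
    have hcont : Continuous fun t : ℝ => S t.toNNReal x :=
      (hS.continuous_orbit x).comp continuous_real_toNNReal
    obtain ⟨C, hC⟩ := (isCompact_Icc (a := (0 : ℝ)) (b := T)).exists_bound_of_continuousOn
      hcont.continuousOn
    exact ⟨C, fun i => hC i i.2⟩
  obtain ⟨C, hC⟩ := banach_steinhaus hb
  exact ⟨max C 1, by positivity, fun t ht => (hC ⟨t, ht⟩).trans (le_max_left _ _)⟩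

/-- The convolution `∫_0^t S_{t-τ} φ(τ) dτ` of a semigroup with a function. -/
noncomputable def duhamel (S : ℝ≥0 → X →L[ℝ] X) (φ : ℝ → X) (t : ℝ) : X :=
  ∫ τ in (0 : ℝ)..t, S (t - τ).toNNReal (φ τ)

/-- Only orbits are continuous, not τ ↦ S_{t-τ} in operator norm, hence the Carathéodory argument.
For τ > t the truncation gives S_0, but the convolution on [0, T] uses only τ ≤ t. -/
theorem IsC0Semigroup.aestronglyMeasurable_apply (hS : IsC0Semigroup S) {μ : Measure ℝ}
    {φ : ℝ → X} (hφ : AEStronglyMeasurable φ μ) (t : ℝ) :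
    AEStronglyMeasurable (fun τ => S (t - τ).toNNReal (φ τ)) μ := by
  refine aestronglyMeasurable_caratheodory (F := fun τ x => S (t - τ).toNNReal x)
    (fun x => ?_) (Eventually.of_forall fun τ => (S _).continuous) hφ
  exact ((hS.continuous_orbit x).comp
    (continuous_real_toNNReal.comp (continuous_sub_left t))).aestronglyMeasurable

theorem intervalIntegrable_of_integrable_Icc {E : Type*} [NormedAddCommGroup E] {T t : ℝ} {φ : ℝ → E}
    (hφ : Integrable φ (volume.restrict (Icc 0 T))) (ht : t ∈ Icc 0 T) :
    IntervalIntegrable φ volume 0 t := by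
  rw [intervalIntegrable_iff_integrableOn_Icc_of_le ht.1]
  exact hφ.mono_measure (Measure.restrict_mono (Icc_subset_Icc_right ht.2) le_rfl)

theorem IsC0Semigroup.norm_apply_le {T M : ℝ} (hM : ∀ t ∈ Icc 0 T, ‖S t.toNNReal‖ ≤ M) {t τ : ℝ}
    (ht : t ∈ Icc 0 T) (hτ : τ ∈ Ioc 0 t) (x : X) : ‖S (t - τ).toNNReal x‖ ≤ M * ‖x‖ :=
  ContinuousLinearMap.le_of_opNorm_le _
    (hM _ ⟨sub_nonneg.2 hτ.2, by linarith [hτ.1, ht.2]⟩) _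

theorem IsC0Semigroup.intervalIntegrable_apply (hS : IsC0Semigroup S) {T M : ℝ}
    (hM : ∀ t ∈ Icc 0 T, ‖S t.toNNReal‖ ≤ M) {φ : ℝ → X}
    (hφ : Integrable φ (volume.restrict (Icc 0 T))) {t : ℝ} (ht : t ∈ Icc 0 T) :
    IntervalIntegrable (fun τ => S (t - τ).toNNReal (φ τ)) volume 0 t := by
  have h1 := intervalIntegrable_of_integrable_Icc hφ ht
  rw [intervalIntegrable_iff_integrableOn_Ioc_of_le ht.1] at h1 ⊢
  refine Integrable.mono' (h1.norm.const_mul M)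
    (hS.aestronglyMeasurable_apply h1.aestronglyMeasurable t) ?_
  filter_upwards [ae_restrict_mem measurableSet_Ioc] with τ hτ
  exact norm_apply_le hM ht hτ _

theorem IsC0Semigroup.norm_duhamel_le {T M : ℝ}
    (hM : ∀ t ∈ Icc 0 T, ‖S t.toNNReal‖ ≤ M) {φ : ℝ → X} {b : ℝ → ℝ} (hM0 : 0 ≤ M)
    (hb : Integrable b (volume.restrict (Icc 0 T)))
    (hφb : ∀ᵐ t ∂(volume.restrict (Icc 0 T)), ‖φ t‖ ≤ b t) {t : ℝ} (ht : t ∈ Icc 0 T) :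
    ‖duhamel S φ t‖ ≤ M * ∫ τ in (0 : ℝ)..t, b τ := by
  have hb1 := intervalIntegrable_of_integrable_Icc hb ht
  rw [duhamel, ← intervalIntegral.integral_const_mul]
  refine intervalIntegral.norm_integral_le_of_norm_le ht.1 ?_ (hb1.const_mul M)
  have h2 := (ae_restrict_iff' measurableSet_Icc).1 hφb
  filter_upwards [h2] with τ h3 hτ
  exact (norm_apply_le hM ht hτ _).trans
    (mul_le_mul_of_nonneg_left (h3 ⟨hτ.1.le, hτ.2.trans ht.2⟩) hM0)

theorem IsC0Semigroup.duhamel_sub (hS : IsC0Semigroup S) {T M : ℝ}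
    (hM : ∀ t ∈ Icc 0 T, ‖S t.toNNReal‖ ≤ M) {φ ψ : ℝ → X}
    (hφ : Integrable φ (volume.restrict (Icc 0 T)))
    (hψ : Integrable ψ (volume.restrict (Icc 0 T))) {t : ℝ} (ht : t ∈ Icc 0 T) :
    duhamel S (fun τ => φ τ - ψ τ) t = duhamel S φ t - duhamel S ψ t := by
  simp only [duhamel, map_sub]
  exact intervalIntegral.integral_sub (hS.intervalIntegrable_apply hM hφ ht)
    (hS.intervalIntegrable_apply hM hψ ht)

/-- With an indicator the domain of integration no longer depends on t; the integrand is then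
continuous at t₀ for every τ ≠ t₀, and dominated convergence applies. -/
theorem IsC0Semigroup.continuousOn_duhamel (hS : IsC0Semigroup S) {T M : ℝ}
    (hM : ∀ t ∈ Icc 0 T, ‖S t.toNNReal‖ ≤ M) {φ : ℝ → X}
    (hφ : Integrable φ (volume.restrict (Icc 0 T))) :
    ContinuousOn (duhamel S φ) (Icc 0 T) := by
  have heq : EqOn (duhamel S φ) (fun t => ∫ τ in Ioc 0 T,
      (Iic t).indicator (fun τ => S (t - τ).toNNReal (φ τ)) τ) (Icc 0 T) := by
    intro t ht
    simp only
    rw [duhamel, intervalIntegral.integral_of_le ht.1, setIntegral_indicator measurableSet_Iic,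
      Ioc_inter_Iic, min_eq_right ht.2]
  have hφ' : Integrable φ (volume.restrict (Ioc 0 T)) :=
    hφ.mono_measure (Measure.restrict_mono Ioc_subset_Icc_self le_rfl)
  refine ContinuousOn.congr (fun t₀ ht₀ => ?_) heq
  refine continuousWithinAt_of_dominated (bound := fun τ => M * ‖φ τ‖) ?_ ?_
    (hφ'.norm.const_mul M) ?_
  · exact Eventually.of_forall fun t =>
      (hS.aestronglyMeasurable_apply hφ'.aestronglyMeasurable t).indicator measurableSet_Iic
  · filter_upwards [self_mem_nhdsWithin] with t ht
    filter_upwards [ae_restrict_mem measurableSet_Ioc] with τ hτ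
    by_cases h : τ ≤ t
    · rw [indicator_of_mem (mem_Iic.2 h)]
      exact norm_apply_le hM ht ⟨hτ.1, h⟩ _
    · rw [indicator_of_notMem (by simpa using h), norm_zero]
      have : 0 ≤ M := (norm_nonneg _).trans (hM t ht)
      positivity
  · have hne : ∀ᵐ τ ∂(volume.restrict (Ioc 0 T)), τ ≠ t₀ :=
      ae_restrict_of_ae (Measure.ae_ne volume t₀)
    filter_upwards [hne] with τ hτ
    refine ContinuousAt.continuousWithinAt ?_
    rcases lt_or_gt_of_ne hτ with h | h
    · have hc : Continuous fun t : ℝ => S (t - τ).toNNReal (φ τ) :=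
        (hS.continuous_orbit _).comp (continuous_real_toNNReal.comp (continuous_sub_right τ))
      refine hc.continuousAt.congr ?_
      filter_upwards [lt_mem_nhds h] with t ht
      rw [indicator_of_mem (mem_Iic.2 ht.le)]
    · refine (continuousAt_const (y := (0 : X))).congr ?_
      filter_upwards [gt_mem_nhds h] with t ht
      rw [indicator_of_notMem (by simpa using ht)]

end Semigroup

/-! ### Passage to intervals, and fields along continuous paths. -/

theorem IccExtend_eqOn {β : Type*} {T : ℝ} (hT : 0 ≤ T) (e : ℝ → β) :
    EqOn (IccExtend hT ((Icc 0 T).domRestrict e)) e (Icc 0 T) := fun t ht => by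
  rw [IccExtend_of_mem _ _ ht, domRestrict_apply]

/-- Integral form of Grönwall's inequality on an interval. -/
theorem integral_le_exp_mul_integral_of_continuousOn {T C : ℝ} (hC : 0 ≤ C) {e r : ℝ → ℝ}
    (he : ContinuousOn e (Icc 0 T)) (hr : ContinuousOn r (Icc 0 T)) (hr0 : ∀ t, 0 ≤ r t)
    (h : ∀ t ∈ Icc 0 T, e t ≤ r t + C * ∫ τ in (0 : ℝ)..t, e τ) {t : ℝ} (ht : t ∈ Icc 0 T) :
    ∫ τ in (0 : ℝ)..t, e τ ≤ Real.exp (C * t) * ∫ τ in (0 : ℝ)..t, r τ := by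
  have hT : 0 ≤ T := ht.1.trans ht.2
  have hint : ∀ (q : ℝ → ℝ), ∀ t ∈ Icc 0 T,
      ∫ τ in (0 : ℝ)..t, IccExtend hT ((Icc 0 T).domRestrict q) τ = ∫ τ in (0 : ℝ)..t, q τ := by
    intro q t ht
    refine intervalIntegral.integral_congr fun τ hτ => ?_
    rw [uIcc_of_le ht.1] at hτ
    exact IccExtend_eqOn hT q ⟨hτ.1, hτ.2.trans ht.2⟩
  have key := integral_le_exp_mul_integral (T := T) hC (e := IccExtend hT ((Icc 0 T).domRestrict e))
    (r := IccExtend hT ((Icc 0 T).domRestrict r)) he.domRestrict.Icc_extend' hr.domRestrict.Icc_extend'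
    (fun t => hr0 _) (fun t ht => ?_) ht
  · rwa [hint e t ht, hint r t ht] at key
  · rw [hint e t ht, IccExtend_eqOn hT e ht, IccExtend_eqOn hT r ht]
    exact h t ht

/-- Lipschitz fields have linear growth, ‖F_t(x)‖ ≤ M‖x‖ + M, which is integrable along a continuous
path. -/
theorem IsLipschitzField.integrable_comp {X Y : Type*} [NormedAddCommGroup X]
    [NormedAddCommGroup Y] {T : ℝ} {F : ℝ → X → Y} (hF : IsLipschitzField T F) {x : ℝ → X}
    (hx : ContinuousOn x (Icc 0 T)) :
    Integrable (fun τ => F τ (x τ)) (volume.restrict (Icc 0 T)) := by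
  obtain ⟨M, hM0, hM⟩ := hF.exists_bound
  have hxi : IntegrableOn x (Icc 0 T) := hx.integrableOn_Icc
  refine Integrable.mono' ((hxi.norm.const_mul M).add (integrable_const M))
    (aestronglyMeasurable_caratheodory hF.aestronglyMeasurable ?_ hxi.aestronglyMeasurable) ?_
  · filter_upwards [hM] with t ht
    exact (LipschitzWith.of_dist_le_mul (K := ⟨M, hM0⟩) fun x y => by
      rw [dist_eq_norm, dist_eq_norm]; exact ht.1 x y).continuous
  · filter_upwards [hM] with t ht
    have h1 := ht.1 (x t) 0
    rw [sub_zero] at h1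
    calc ‖F t (x t)‖ ≤ ‖F t (x t) - F t 0‖ + ‖F t 0‖ := by
          simpa using norm_add_le (F t (x t) - F t 0) (F t 0)
      _ ≤ M * ‖x t‖ + M := add_le_add h1 ht.2

/-! ### Mild solutions: stability, uniqueness, existence. -/

section Mild

variable {X : Type*} [NormedAddCommGroup X] [NormedSpace ℝ X] {S : ℝ≥0 → X →L[ℝ] X}

/-- Two mild solutions for different fields differ by the Duhamel integral of the difference of
the fields along one of them, up to a Grönwall term. -/
theorem norm_mild_sub_le (hS : IsC0Semigroup S) {T M L : ℝ} (hM0 : 0 ≤ M)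
    (hM : ∀ t ∈ Icc 0 T, ‖S t.toNNReal‖ ≤ M) {F H : ℝ → X → X} (hF : IsLipschitzField T F)
    (hH : IsLipschitzField T H)
    (hL : ∀ᵐ t ∂(volume.restrict (Icc 0 T)), ∀ x y : X, ‖F t x - F t y‖ ≤ L * ‖x - y‖)
    {x₀ : X} {x y : ℝ → X} (hx : ContinuousOn x (Icc 0 T)) (hy : ContinuousOn y (Icc 0 T))
    (hxF : ∀ t ∈ Icc 0 T, x t = S t.toNNReal x₀ + duhamel S (fun τ => F τ (x τ)) t)
    (hyH : ∀ t ∈ Icc 0 T, y t = S t.toNNReal x₀ + duhamel S (fun τ => H τ (y τ)) t)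
    {t : ℝ} (ht : t ∈ Icc 0 T) :
    ‖x t - y t‖ ≤ ‖duhamel S (fun τ => F τ (y τ) - H τ (y τ)) t‖ +
      M * L * ∫ τ in (0 : ℝ)..t, ‖x τ - y τ‖ := by
  -- F(x) - H(y) is split at F(y), so the two fields are compared along `y` alone.
  have h1 : x t - y t = duhamel S (fun τ => F τ (y τ) - H τ (y τ)) t +
      duhamel S (fun τ => F τ (x τ) - F τ (y τ)) t := by
    rw [hS.duhamel_sub hM (hF.integrable_comp hy) (hH.integrable_comp hy) ht,
      hS.duhamel_sub hM (hF.integrable_comp hx) (hF.integrable_comp hy) ht, hxF t ht, hyH t ht]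
    abel
  rw [h1]
  refine (norm_add_le _ _).trans (add_le_add_right ?_ _)
  have hi : Integrable (fun τ => L * ‖x τ - y τ‖) (volume.restrict (Icc 0 T)) :=
    ((hx.sub hy).norm.integrableOn_Icc (μ := volume)).const_mul L
  refine (IsC0Semigroup.norm_duhamel_le hM hM0 hi ?_ ht).trans_eq ?_
  · filter_upwards [hL] with τ hτ
    exact hτ _ _
  · rw [intervalIntegral.integral_const_mul, mul_assoc]

/-- Uniqueness of mild solutions. -/
theorem mild_unique [CompleteSpace X] (hS : IsC0Semigroup S) {T : ℝ} {F : ℝ → X → X}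
    (hF : IsLipschitzField T F)
    {x₀ : X} {x y : ℝ → X} (hx : ContinuousOn x (Icc 0 T)) (hy : ContinuousOn y (Icc 0 T))
    (hxF : ∀ t ∈ Icc 0 T, x t = S t.toNNReal x₀ + duhamel S (fun τ => F τ (x τ)) t)
    (hyF : ∀ t ∈ Icc 0 T, y t = S t.toNNReal x₀ + duhamel S (fun τ => F τ (y τ)) t) :
    EqOn x y (Icc 0 T) := by
  obtain ⟨M, hM0, hM⟩ := hS.exists_norm_le T
  obtain ⟨L, hL0, hL⟩ := hF.exists_bound
  have key : ∀ t ∈ Icc 0 T, ‖x t - y t‖ ≤ 0 + M * L * ∫ τ in (0 : ℝ)..t, ‖x τ - y τ‖ := by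
    intro t ht
    have h1 := norm_mild_sub_le hS hM0.le hM hF hF (hL.mono fun _ h => h.1) hx hy hxF hyF ht
    simpa [duhamel] using h1
  have hK : 0 ≤ M * L := by positivity
  intro t ht
  have h2 := integral_le_exp_mul_integral_of_continuousOn hK (hx.sub hy).norm
    (continuousOn_const (c := (0 : ℝ))) (fun _ => le_rfl) key ht
  have h3 : ∫ τ in (0 : ℝ)..t, ‖x τ - y τ‖ ≤ 0 := by simpa using h2
  have h4 := key t ht
  have h5 : ‖x t - y t‖ ≤ 0 := by nlinarith
  exact sub_eq_zero.1 (norm_le_zero_iff.1 h5)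

/-- Existence of mild solutions. -/
theorem exists_mild [CompleteSpace X] (hS : IsC0Semigroup S) {T : ℝ} (hT : 0 ≤ T)
    {F : ℝ → X → X} (hF : IsLipschitzField T F) (x₀ : X) :
    ∃ x : ℝ → X, ContinuousOn x (Icc 0 T) ∧
      ∀ t ∈ Icc 0 T, x t = S t.toNNReal x₀ + duhamel S (fun τ => F τ (x τ)) t := by
  obtain ⟨M, hM0, hM⟩ := hS.exists_norm_le T
  obtain ⟨L, hL0, hL⟩ := hF.exists_bound
  have : Nonempty (Icc 0 T) := ⟨⟨0, left_mem_Icc.2 hT⟩⟩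
  have hext : ∀ x : C(Icc 0 T, X), ContinuousOn (IccExtend hT x) (Icc 0 T) :=
    fun x => x.continuous.Icc_extend'.continuousOn
  have hΦc : ∀ x : C(Icc 0 T, X), ContinuousOn (fun t => S t.toNNReal x₀ +
      duhamel S (fun τ => F τ (IccExtend hT x τ)) t) (Icc 0 T) := fun x =>
    ((hS.continuous_orbit x₀).comp continuous_real_toNNReal).continuousOn.add
      (hS.continuousOn_duhamel hM (hF.integrable_comp (hext x)))
  let Φ : C(Icc 0 T, X) → C(Icc 0 T, X) := fun x => ⟨_, (hΦc x).domRestrict⟩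
  have hΦ : ∀ x (t : Icc 0 T), Φ x t = S (t : ℝ).toNNReal x₀ +
      duhamel S (fun τ => F τ (IccExtend hT x τ)) t := fun _ _ => rfl
  -- The factorial from iterated time integration makes some iterate a contraction on all of [0, T],
  -- with no smallness of T. Its fixed point is also fixed by `Φ`.
  have hiter : ∀ (n : ℕ) (x y : C(Icc 0 T, X)) (t : Icc 0 T),
      ‖Φ^[n] x t - Φ^[n] y t‖ ≤ (M * L * t) ^ n / n.factorial * dist x y := by
    intro n x y
    induction n with
    | zero =>
      intro t
      simpa [dist_eq_norm] using ContinuousMap.dist_apply_le_dist (f := x) (g := y) t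
    | succ n ih =>
      intro t
      rw [Function.iterate_succ_apply', Function.iterate_succ_apply', hΦ, hΦ,
        add_sub_add_left_eq_sub, ← hS.duhamel_sub hM (hF.integrable_comp (hext _))
          (hF.integrable_comp (hext _)) t.2]
      have hb : Continuous fun τ : ℝ => L * ((M * L * τ) ^ n / n.factorial * dist x y) := by
        fun_prop
      refine (IsC0Semigroup.norm_duhamel_le hM hM0.le hb.integrableOn_Icc ?_ t.2).trans_eq ?_
      · filter_upwards [hL, ae_restrict_mem measurableSet_Icc] with τ hτ hτm
        refine (hτ.1 _ _).trans (mul_le_mul_of_nonneg_left ?_ hL0)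
        rw [IccExtend_of_mem _ _ hτm, IccExtend_of_mem _ _ hτm]
        exact ih ⟨τ, hτm⟩
      · have h1 : ∀ τ : ℝ, L * ((M * L * τ) ^ n / n.factorial * dist x y) =
            L * (M * L) ^ n / n.factorial * dist x y * τ ^ n := fun τ => by
          rw [mul_pow]; ring
        simp only [h1]
        rw [intervalIntegral.integral_const_mul, integral_pow, Nat.factorial_succ]
        push_cast
        have h2 : (n.factorial : ℝ) ≠ 0 := by positivity
        have h3 : ((n : ℝ) + 1) ≠ 0 := by positivity
        field_simp
        ring
  obtain ⟨n, hn⟩ := ((FloorSemiring.tendsto_pow_div_factorial_atTop (M * L * T)).eventually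
    (gt_mem_nhds one_pos)).exists
  have hc : ContractingWith ((M * L * T) ^ n / n.factorial).toNNReal Φ^[n] := by
    refine ⟨Real.toNNReal_lt_one.2 hn, LipschitzWith.of_dist_le_mul fun x y => ?_⟩
    rw [Real.coe_toNNReal _ (by positivity), ContinuousMap.dist_le (mul_nonneg (by positivity) dist_nonneg)]
    intro t
    rw [dist_eq_norm]
    refine (hiter n x y t).trans (mul_le_mul_of_nonneg_right ?_ dist_nonneg)
    have h1 : 0 ≤ (t : ℝ) := t.2.1
    have h2 : (t : ℝ) ≤ T := t.2.2
    gcongr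
  have hfix := hc.isFixedPt_fixedPoint_iterate
  set x := hc.fixedPoint Φ^[n]
  refine ⟨IccExtend hT x, hext x, fun t ht => ?_⟩
  rw [IccExtend_of_mem _ _ ht]
  conv_lhs => rw [← hfix]
  exact hΦ x ⟨t, ht⟩

end Mild

/-! ### Weak-to-strong dependence of trajectories on the control. -/

section Control

variable {X : Type*} [NormedAddCommGroup X] [NormedSpace ℝ X] {m : ℕ}

/-- The field `f + G u` is uniformly Lipschitz for uniformly bounded controls `u`. -/
theorem exists_bound_controlledField {T : ℝ} {f : ℝ → X → X}
    {G : ℝ → X → EuclideanSpace ℝ (Fin m) →L[ℝ] X} (hf : IsLipschitzField T f)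
    (hG : IsLipschitzField T G) {R : ℝ} (hR : 0 ≤ R) :
    ∃ L, 0 ≤ L ∧ ∀ u : ℝ → EuclideanSpace ℝ (Fin m),
      (∀ᵐ t ∂(volume.restrict (Icc 0 T)), ‖u t‖ ≤ R) →
      ∀ᵐ t ∂(volume.restrict (Icc 0 T)),
        (∀ x y, ‖(f t x + G t x (u t)) - (f t y + G t y (u t))‖ ≤ L * ‖x - y‖) ∧
          ‖f t 0 + G t 0 (u t)‖ ≤ L := by
  obtain ⟨M, hM0, hM⟩ := hf.exists_bound
  obtain ⟨N, hN0, hN⟩ := hG.exists_bound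
  -- Chosen before `u`, so that one Grönwall constant serves a whole sequence of controls.
  refine ⟨M + N * R, by positivity, fun u hu => ?_⟩
  filter_upwards [hM, hN, hu] with t h1 h2 h3
  constructor
  · intro x y
    have h4 : (f t x + G t x (u t)) - (f t y + G t y (u t)) =
        (f t x - f t y) + (G t x - G t y) (u t) := by
      rw [_root_.sub_apply]; abel
    rw [h4]
    calc _ ≤ ‖f t x - f t y‖ + ‖G t x - G t y‖ * ‖u t‖ :=
          (norm_add_le _ _).trans (add_le_add_right (ContinuousLinearMap.le_opNorm _ _) _)
      _ ≤ M * ‖x - y‖ + (N * ‖x - y‖) * R := by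
          gcongr
          · exact h1.1 x y
          · exact h2.1 x y
      _ = _ := by ring
  · calc _ ≤ ‖f t 0‖ + ‖G t 0‖ * ‖u t‖ :=
          (norm_add_le _ _).trans (add_le_add_right (ContinuousLinearMap.le_opNorm _ _) _)
      _ ≤ M + N * R := by
          gcongr
          · exact h1.2
          · exact h2.2

theorem isLipschitzField_controlledField {T : ℝ} {f : ℝ → X → X}
    {G : ℝ → X → EuclideanSpace ℝ (Fin m) →L[ℝ] X} (hf : IsLipschitzField T f)
    (hG : IsLipschitzField T G) {R : ℝ} (hR : 0 ≤ R) {u : ℝ → EuclideanSpace ℝ (Fin m)}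
    (hum : AEStronglyMeasurable u (volume.restrict (Icc 0 T)))
    (hu : ∀ᵐ t ∂(volume.restrict (Icc 0 T)), ‖u t‖ ≤ R) :
    IsLipschitzField T fun t x => f t x + G t x (u t) where
  aestronglyMeasurable x :=
    (hf.aestronglyMeasurable x).add ((ContinuousLinearMap.id ℝ _).aestronglyMeasurable_comp₂
      (hG.aestronglyMeasurable x) hum)
  exists_bound := by
    obtain ⟨L, hL0, hL⟩ := exists_bound_controlledField hf hG hR
    exact ⟨L, hL0, hL u hu⟩

/-- The integrability clause is automatic for a Lipschitz field along a continuous path. -/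
theorem isMildSolution_iff {T : ℝ} {S : ℝ≥0 → X →L[ℝ] X} [CompleteSpace X]
    (hS : IsC0Semigroup S) {f : ℝ → X → X}
    {G : ℝ → X → EuclideanSpace ℝ (Fin m) →L[ℝ] X} {u : ℝ → EuclideanSpace ℝ (Fin m)}
    (hF : IsLipschitzField T fun t x => f t x + G t x (u t)) {x₀ : X} {x : ℝ → X} :
    IsMildSolution T S f G x₀ u x ↔ ContinuousOn x (Icc 0 T) ∧ ∀ t ∈ Icc 0 T,
      x t = S t.toNNReal x₀ + duhamel S (fun τ => f τ (x τ) + G τ (x τ) (u τ)) t := by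
  refine ⟨fun h => ⟨h.continuousOn, h.eq_integral⟩, fun h => ⟨h.1, fun t ht => ?_, h.2⟩⟩
  obtain ⟨M, -, hM⟩ := hS.exists_norm_le T
  exact hS.intervalIntegrable_apply hM (hF.integrable_comp h.1) ht

/-- The Duhamel integrals of the channel terms depend continuously on the control for the weak
topology. -/
theorem tendsto_duhamel_channels [CompleteSpace X] {S : ℝ≥0 → X →L[ℝ] X} (hS : IsC0Semigroup S)
    {T R : ℝ} {γ : Fin m → ℝ → EuclideanSpace ℝ (Fin m)} {B : ℝ}
    (hγm : ∀ j, AEStronglyMeasurable (γ j) (volume.restrict (Icc 0 T)))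
    (hγB : ∀ j, ∀ᵐ t ∂(volume.restrict (Icc 0 T)), ‖γ j t‖ ≤ B) (h : Fin m → X)
    {w : ℕ → ℝ → EuclideanSpace ℝ (Fin m)}
    (hwm : ∀ n, AEStronglyMeasurable (w n) (volume.restrict (Icc 0 T)))
    (hwR : ∀ n, ∀ᵐ t ∂(volume.restrict (Icc 0 T)), ‖w n t‖ ≤ R)
    (hw : ∀ ψ : ℝ → EuclideanSpace ℝ (Fin m), MemLp ψ 2 (volume.restrict (Icc 0 T)) →
      Tendsto (fun n => ∫ t in Icc 0 T, ⟪ψ t, w n t⟫) atTop (𝓝 0))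
    {t : ℝ} (ht : t ∈ Icc 0 T) :
    Tendsto (fun n => duhamel S (fun τ => ∑ j, ⟪w n τ, γ j τ⟫ • h j) t) atTop (𝓝 0) := by
  obtain ⟨M, hM0, hM⟩ := hS.exists_norm_le T
  have hk : ∀ j, Integrable ((Ioc 0 t).indicator fun τ => S (t - τ).toNNReal (h j))
      (volume.restrict (Icc 0 T)) := by
    intro j
    have h1 := hS.intervalIntegrable_apply hM (φ := fun _ => h j) (integrable_const _) ht
    rw [intervalIntegrable_iff_integrableOn_Ioc_of_le ht.1] at h1
    exact ((integrable_indicator_iff measurableSet_Ioc).2 h1).restrict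
  have hmeas : ∀ n j, AEStronglyMeasurable (fun τ => ⟪w n τ, γ j τ⟫)
      (volume.restrict (Icc 0 T)) := fun n j => (hwm n).inner (hγm j)
  have hbd : ∀ n j, ∀ᵐ τ ∂(volume.restrict (Icc 0 T)), ‖⟪w n τ, γ j τ⟫‖ ≤ R * B := by
    intro n j
    filter_upwards [hwR n, hγB j] with τ h1 h2
    exact (norm_inner_le_norm _ _).trans
      (mul_le_mul h1 h2 (norm_nonneg _) ((norm_nonneg _).trans h1))
  have heq : ∀ n, duhamel S (fun τ => ∑ j, ⟪w n τ, γ j τ⟫ • h j) t =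
      ∑ j, ∫ τ in Icc 0 T, ⟪w n τ, γ j τ⟫ •
        (Ioc 0 t).indicator (fun τ => S (t - τ).toNNReal (h j)) τ := by
    intro n
    have hint : ∀ j ∈ Finset.univ, Integrable (fun τ => ⟪w n τ, γ j τ⟫ •
        (Ioc 0 t).indicator (fun τ => S (t - τ).toNNReal (h j)) τ) (volume.restrict (Icc 0 T)) :=
      fun j _ => (hk j).bdd_smul (R * B) (hmeas n j) (hbd n j)
    have hrestrict : ∀ q : ℝ → X,
        ∫ τ in Ioc 0 t, q τ = ∫ τ in Icc 0 T, (Ioc 0 t).indicator q τ := fun q => by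
      rw [setIntegral_indicator measurableSet_Ioc,
        inter_eq_right.2 (Ioc_subset_Icc_self.trans (Icc_subset_Icc_right ht.2))]
    rw [← integral_finsetSum _ hint, duhamel, intervalIntegral.integral_of_le ht.1, hrestrict]
    congr 1
    funext τ
    by_cases hτ : τ ∈ Ioc 0 t
    · simp [indicator_of_mem hτ, map_sum]
    · simp [indicator_of_notMem hτ]
  simp only [heq]
  suffices hlim : ∀ j, ∀ s, MeasurableSet s →
      Tendsto (fun n => ∫ τ in s, ⟪w n τ, γ j τ⟫ ∂(volume.restrict (Icc 0 T))) atTop (𝓝 0) by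
    simpa only [Finset.sum_const_zero] using tendsto_finsetSum Finset.univ fun j _ =>
      tendsto_integral_smul_of_tendsto_setIntegral (fun n => hmeas n j) (fun n => hbd n j)
        (hlim j) (hk j)
  intro j s hs
  -- Weak convergence tested on γ_j restricted to s is exactly convergence of the set integrals.
  refine (hw (s.indicator (γ j)) ((MemLp.of_bound (hγm j) B (hγB j)).indicator hs)).congr
    fun n => ?_
  rw [← integral_indicator hs]
  congr 1
  funext τ
  by_cases hτ : τ ∈ s
  · simp [indicator_of_mem hτ, real_inner_comm]
  · simp [indicator_of_notMem hτ]

/-- The final state depends continuously on the control for the weak topology. -/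
theorem tendsto_final_state [CompleteSpace X] {S : ℝ≥0 → X →L[ℝ] X} (hS : IsC0Semigroup S)
    {T R : ℝ} (hT : 0 ≤ T) (hR : 0 ≤ R) {f : ℝ → X → X}
    {G : ℝ → X → EuclideanSpace ℝ (Fin m) →L[ℝ] X} (hf : IsLipschitzField T f)
    (hG : IsLipschitzField T G) {g : Fin m → ℝ → X → EuclideanSpace ℝ (Fin m)} {h : Fin m → X}
    (hGgh : HasFiniteChannels T G g h) {x₀ : X}
    {u : ℕ → ℝ → EuclideanSpace ℝ (Fin m)} {v : ℝ → EuclideanSpace ℝ (Fin m)}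
    (hum : ∀ n, AEStronglyMeasurable (u n) (volume.restrict (Icc 0 T)))
    (huR : ∀ n, ∀ᵐ t ∂(volume.restrict (Icc 0 T)), ‖u n t‖ ≤ R)
    (hvm : AEStronglyMeasurable v (volume.restrict (Icc 0 T)))
    (hvR : ∀ᵐ t ∂(volume.restrict (Icc 0 T)), ‖v t‖ ≤ R)
    (huv : ∀ ψ : ℝ → EuclideanSpace ℝ (Fin m), MemLp ψ 2 (volume.restrict (Icc 0 T)) →
      Tendsto (fun n => ∫ t in Icc 0 T, ⟪ψ t, u n t⟫) atTop (𝓝 (∫ t in Icc 0 T, ⟪ψ t, v t⟫)))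
    {x : ℕ → ℝ → X} {y : ℝ → X} (hx : ∀ n, IsMildSolution T S f G x₀ (u n) (x n))
    (hy : IsMildSolution T S f G x₀ v y) :
    Tendsto (fun n => x n T) atTop (𝓝 (y T)) := by
  obtain ⟨M, hM0, hM⟩ := hS.exists_norm_le T
  obtain ⟨L, hL0, hL⟩ := exists_bound_controlledField hf hG hR
  obtain ⟨Y, hY⟩ := isCompact_Icc.exists_bound_of_continuousOn hy.continuousOn
  have hFu := fun n => isLipschitzField_controlledField hf hG hR (hum n) (huR n)
  have hFv := isLipschitzField_controlledField hf hG hR hvm hvR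
  have hcomp_bound : ∀ {Z : Type} [NormedAddCommGroup Z] {φ : ℝ → X → Z},
      IsLipschitzField T φ → ∃ B, ∀ᵐ t ∂(volume.restrict (Icc 0 T)), ‖φ t (y t)‖ ≤ B := by
    intro Z _ φ hφ
    obtain ⟨N, hN0, hN⟩ := hφ.exists_bound
    refine ⟨N * Y + N, ?_⟩
    filter_upwards [hN, ae_restrict_mem measurableSet_Icc] with t h1 h2
    calc ‖φ t (y t)‖ ≤ ‖φ t (y t) - φ t 0‖ + ‖φ t 0‖ := by
          simpa using norm_add_le (φ t (y t) - φ t 0) (φ t 0)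
      _ ≤ N * ‖y t - 0‖ + N := add_le_add (h1.1 _ _) h1.2
      _ ≤ N * Y + N := by
          rw [sub_zero]
          gcongr
          exact hY t h2
  choose Bj hBj using fun j => hcomp_bound (hGgh.isLipschitzField j)
  have hB : ∀ j, ∀ᵐ t ∂(volume.restrict (Icc 0 T)), ‖g j t (y t)‖ ≤ ∑ i, |Bj i| := by
    intro j
    filter_upwards [hBj j] with t ht
    exact (ht.trans (le_abs_self _)).trans
      (Finset.single_le_sum (f := fun i => |Bj i|) (fun i _ => abs_nonneg _) (Finset.mem_univ j))
  set B := ∑ i, |Bj i|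
  have hwR : ∀ n, ∀ᵐ t ∂(volume.restrict (Icc 0 T)), ‖u n t - v t‖ ≤ 2 * R := by
    intro n
    filter_upwards [huR n, hvR] with t h1 h2
    exact (norm_sub_le _ _).trans (by linarith)
  have hdiff : ∀ n, ∀ τ ∈ Icc 0 T, (f τ (y τ) + G τ (y τ) (u n τ)) - (f τ (y τ) + G τ (y τ) (v τ))
      = ∑ j, ⟪u n τ - v τ, g j τ (y τ)⟫ • h j := by
    intro n τ hτ
    rw [← hGgh.apply_eq τ hτ, map_sub]
    abel
  let z : ℕ → ℝ → X := fun n =>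
    duhamel S fun τ => (f τ (y τ) + G τ (y τ) (u n τ)) - (f τ (y τ) + G τ (y τ) (v τ))
  have hz : ∀ t ∈ Icc 0 T, Tendsto (fun n => z n t) atTop (𝓝 0) := by
    intro t ht
    have h1 := tendsto_duhamel_channels hS
      (fun j => ((hGgh.isLipschitzField j).integrable_comp hy.continuousOn).aestronglyMeasurable)
      hB h (w := fun n τ => u n τ - v τ) (fun n => (hum n).sub hvm) hwR ?_ ht
    · refine h1.congr fun n => intervalIntegral.integral_congr fun τ hτ => ?_
      rw [uIcc_of_le ht.1] at hτ
      simp only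
      rw [hdiff n τ ⟨hτ.1, hτ.2.trans ht.2⟩]
    · intro ψ hψ
      have hi : ∀ {q : ℝ → EuclideanSpace ℝ (Fin m)},
          AEStronglyMeasurable q (volume.restrict (Icc 0 T)) →
          (∀ᵐ t ∂(volume.restrict (Icc 0 T)), ‖q t‖ ≤ R) →
          Integrable (fun t => ⟪ψ t, q t⟫) (volume.restrict (Icc 0 T)) :=
        fun {q} hq hqR => by
          refine Integrable.mono' ((hψ.integrable one_le_two).norm.mul_const R)
            (hψ.aestronglyMeasurable.inner hq) ?_
          filter_upwards [hqR] with t ht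
          exact (norm_inner_le_norm _ _).trans (mul_le_mul_of_nonneg_left ht (norm_nonneg _))
      have h2 := (huv ψ hψ).sub_const (∫ t in Icc 0 T, ⟪ψ t, v t⟫)
      rw [sub_self] at h2
      refine h2.congr fun n => ?_
      rw [← integral_sub (hi (hum n) (huR n)) (hi hvm hvR)]
      simp only [inner_sub_right]
  have hzb : ∀ n, ∀ t ∈ Icc 0 T, ‖z n t‖ ≤ M * (T * ∑ j, 2 * R * B * ‖h j‖) := by
    intro n t ht
    have hb0 : 0 ≤ ∑ j, 2 * R * B * ‖h j‖ := by
      have : 0 ≤ B := Finset.sum_nonneg fun i _ => abs_nonneg _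
      positivity
    refine (IsC0Semigroup.norm_duhamel_le hM hM0.le
      (integrable_const (∑ j, 2 * R * B * ‖h j‖)) ?_ ht).trans ?_
    · filter_upwards [hwR n, ae_all_iff.2 hB, ae_restrict_mem measurableSet_Icc] with τ h1 h2 h3
      rw [hdiff n τ h3]
      refine (norm_sum_le _ _).trans (Finset.sum_le_sum fun j _ => ?_)
      rw [norm_smul]
      gcongr
      exact (norm_inner_le_norm _ _).trans
        (mul_le_mul h1 (h2 j) (norm_nonneg _) (by positivity))
    · rw [intervalIntegral.integral_const, smul_eq_mul, sub_zero]
      gcongr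
      exact ht.2
  set K := M * L
  have hK : 0 ≤ K := by positivity
  let e : ℕ → ℝ → ℝ := fun n t => ‖x n t - y t‖
  have hec : ∀ n, ContinuousOn (e n) (Icc 0 T) := fun n =>
    ((hx n).continuousOn.sub hy.continuousOn).norm
  have hez : ∀ n, ∀ t ∈ Icc 0 T, e n t ≤ ‖z n t‖ + K * ∫ τ in (0 : ℝ)..t, e n τ := fun n t ht =>
    norm_mild_sub_le hS hM0.le hM (hFu n) hFv ((hL _ (huR n)).mono fun _ h => h.1)
      (hx n).continuousOn hy.continuousOn (hx n).eq_integral hy.eq_integral ht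
  -- The positive part of the Grönwall defect: continuous because `e` is, with e ≤ r + K∫e by
  -- construction, and dominated by ‖z_n‖ on [0, T].
  let r : ℕ → ℝ → ℝ := fun n t => max (e n t - K * ∫ τ in (0 : ℝ)..t, e n τ) 0
  have hr0 : ∀ n t, 0 ≤ r n t := fun n t => le_max_right _ _
  have hrz : ∀ n, ∀ t ∈ Icc 0 T, r n t ≤ ‖z n t‖ := fun n t ht =>
    max_le (by linarith [hez n t ht]) (norm_nonneg _)
  have hrc : ∀ n, ContinuousOn (r n) (Icc 0 T) := by
    intro n
    have h1 := intervalIntegral.continuousOn_primitive_interval (a := (0 : ℝ)) (b := T)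
      (f := e n) (μ := volume) (by rw [uIcc_of_le hT]; exact (hec n).integrableOn_Icc)
    rw [uIcc_of_le hT] at h1
    exact ((hec n).sub (continuousOn_const.mul h1)).sup continuousOn_const
  have hTm : T ∈ Icc 0 T := right_mem_Icc.2 hT
  have hgron : ∀ n, ∫ τ in (0 : ℝ)..T, e n τ ≤
      Real.exp (K * T) * ∫ τ in (0 : ℝ)..T, r n τ := fun n =>
    integral_le_exp_mul_integral_of_continuousOn hK (hec n) (hrc n) (hr0 n)
      (fun t _ => by linarith [le_max_left (e n t - K * ∫ τ in (0 : ℝ)..t, e n τ) 0]) hTm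
  have hrlim : Tendsto (fun n => ∫ τ in (0 : ℝ)..T, r n τ) atTop (𝓝 0) := by
    have h1 : Tendsto (fun n => ∫ τ in (0 : ℝ)..T, r n τ) atTop
        (𝓝 (∫ τ in (0 : ℝ)..T, (0 : ℝ))) := by
      refine intervalIntegral.tendsto_integral_filter_of_dominated_convergence
        (fun _ => M * (T * ∑ j, 2 * R * B * ‖h j‖)) (Eventually.of_forall fun n => ?_)
        (Eventually.of_forall fun n => ?_) intervalIntegrable_const ?_
      · rw [uIoc_of_le hT]
        exact ((hrc n).mono Ioc_subset_Icc_self).aestronglyMeasurable measurableSet_Ioc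
      · refine Eventually.of_forall fun t ht => ?_
        rw [uIoc_of_le hT] at ht
        have ht' := Ioc_subset_Icc_self ht
        rw [Real.norm_of_nonneg (hr0 n t)]
        exact (hrz n t ht').trans (hzb n t ht')
      · refine Eventually.of_forall fun t ht => ?_
        rw [uIoc_of_le hT] at ht
        have ht' := Ioc_subset_Icc_self ht
        exact squeeze_zero (fun n => hr0 n t) (fun n => hrz n t ht')
          (tendsto_zero_iff_norm_tendsto_zero.1 (hz t ht'))
    simpa using h1
  rw [tendsto_iff_norm_sub_tendsto_zero]
  refine squeeze_zero (g := fun n => ‖z n T‖ + K * (Real.exp (K * T) * ∫ τ in (0 : ℝ)..T, r n τ))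
    (fun n => norm_nonneg _) (fun n => ?_) ?_
  · exact (hez n T hTm).trans (add_le_add_right (mul_le_mul_of_nonneg_left (hgron n) hK) _)
  · simpa using (tendsto_zero_iff_norm_tendsto_zero.1 (hz T hTm)).add
      ((hrlim.const_mul (Real.exp (K * T))).const_mul K)

end Control

/-! ### Lower semicontinuity and minimizing sequences. -/

/-- Weak lower semicontinuity of the control cost, in the form of a lower bound. -/
theorem two_mul_integral_inner_sub_le {α E : Type*} [MeasurableSpace α] {μ : Measure α}
    [NormedAddCommGroup E] [InnerProductSpace ℝ E] {u v : α → E} (hu : MemLp u 2 μ)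
    (hv : MemLp v 2 μ) :
    2 * (∫ t, ⟪v t, u t⟫ ∂μ) - ∫ t, ‖v t‖ ^ 2 ∂μ ≤ ∫ t, ‖u t‖ ^ 2 ∂μ := by
  have hi : Integrable (fun t => ⟪v t, u t⟫) μ := by
    refine (MemLp.integrable_mul hv.norm hu.norm).mono'
      (hv.aestronglyMeasurable.inner hu.aestronglyMeasurable) (Eventually.of_forall fun t => ?_)
    exact norm_inner_le_norm _ _
  rw [← integral_const_mul, ← integral_sub (hi.const_mul 2) hv.norm.integrable_sq]
  refine integral_mono ((hi.const_mul 2).sub hv.norm.integrable_sq) hu.norm.integrable_sq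
    fun t => ?_
  -- Expanding 0 ≤ ‖v - u‖² bounds ‖u‖² below by its tangent at v, which is affine in u and so
  -- passes to weak limits.
  have h1 := norm_sub_sq_real (v t) (u t)
  have h2 := sq_nonneg ‖v t - u t‖
  simp only
  linarith

/-- A real-valued function on a nonempty type admits a minimizing sequence, even if it is not
bounded below. -/
theorem exists_minimizing_seq {ι : Type*} [Nonempty ι] (J : ι → ℝ) :
    ∃ s : ℕ → ι, ∀ i, ∀ b, J i < b → ∀ᶠ n in atTop, J (s n) < b := by
  obtain ⟨c, -, hc, hmem⟩ := exists_seq_tendsto_sInf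
    (range_nonempty fun i => (J i : EReal)) (OrderBot.bddBelow _)
  choose s hs using hmem
  refine ⟨s, fun i b hb => ?_⟩
  have h1 : sInf (range fun i => (J i : EReal)) < (b : EReal) :=
    (sInf_le (mem_range_self i)).trans_lt (EReal.coe_lt_coe_iff.2 hb)
  filter_upwards [hc.eventually (gt_mem_nhds h1)] with n hn
  rw [← hs n] at hn
  exact EReal.coe_lt_coe_iff.1 hn

end OptimalControl

/-! ### The direct method. -/

theorem mainTheorem2 {X : Type*} [NormedAddCommGroup X] [NormedSpace ℝ X] [CompleteSpace X]
    {m : ℕ} (T α : ℝ) (hT : 0 < T) (hα : 0 ≤ α)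
    (U : Set (EuclideanSpace ℝ (Fin m))) (hU_compact : IsCompact U) (hU_convex : Convex ℝ U)
    (hU_nonempty : U.Nonempty)
    (A : X →ₗ.[ℝ] X) (S : ℝ≥0 → X →L[ℝ] X)
    (hS : OptimalControl.IsC0Semigroup S) (hA : OptimalControl.IsGenerator A S)
    (x₀ : X) (f : ℝ → X → X) (G : ℝ → X → EuclideanSpace ℝ (Fin m) →L[ℝ] X)
    (hf : OptimalControl.IsLipschitzField T f) (hG : OptimalControl.IsLipschitzField T G)
    (ℓ : X → ℝ) (hℓ : LowerSemicontinuous ℓ)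
    (g : Fin m → ℝ → X → EuclideanSpace ℝ (Fin m)) (h : Fin m → X)
    (hGgh : OptimalControl.HasFiniteChannels T G g h) :
    (∀ u ∈ OptimalControl.admissibleControls T U, ∃ x : ℝ → X,
      OptimalControl.IsMildSolution T S f G x₀ u x ∧
      ∀ y : ℝ → X, OptimalControl.IsMildSolution T S f G x₀ u y → EqOn y x (Icc 0 T)) ∧
    ∃ u ∈ OptimalControl.admissibleControls T U, ∃ x : ℝ → X,
      OptimalControl.IsMildSolution T S f G x₀ u x ∧
      ∀ v ∈ OptimalControl.admissibleControls T U, ∀ y : ℝ → X,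
        OptimalControl.IsMildSolution T S f G x₀ v y →
          OptimalControl.cost T α ℓ u x ≤ OptimalControl.cost T α ℓ v y := by
  obtain ⟨R₀, hR₀⟩ := hU_compact.isBounded.exists_norm_le
  obtain ⟨R, hR, hUR⟩ : ∃ R, 0 ≤ R ∧ ∀ x ∈ U, ‖x‖ ≤ R :=
    ⟨|R₀|, abs_nonneg _, fun x hx => (hR₀ x hx).trans (le_abs_self _)⟩
  have hbd : ∀ u ∈ OptimalControl.admissibleControls T U,
      ∀ᵐ t ∂(volume.restrict (Icc 0 T)), ‖u t‖ ≤ R := fun u hu =>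
    Eventually.mono hu fun t ht => hUR _ ht
  have hfield : ∀ u ∈ OptimalControl.admissibleControls T U,
      OptimalControl.IsLipschitzField T fun t x => f t x + G t x (u t) := fun u hu =>
    OptimalControl.isLipschitzField_controlledField hf hG hR (Lp.aestronglyMeasurable u) (hbd u hu)
  have hmild : ∀ u ∈ OptimalControl.admissibleControls T U, ∃ x : ℝ → X,
      OptimalControl.IsMildSolution T S f G x₀ u x ∧
      ∀ y : ℝ → X, OptimalControl.IsMildSolution T S f G x₀ u y → EqOn y x (Icc 0 T) := by
    intro u hu
    obtain ⟨x, hxc, hx⟩ := OptimalControl.exists_mild hS hT.le (hfield u hu) x₀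
    exact ⟨x, (OptimalControl.isMildSolution_iff hS (hfield u hu)).2 ⟨hxc, hx⟩, fun y hy =>
      OptimalControl.mild_unique hS (hfield u hu) hy.continuousOn hxc hy.eq_integral hx⟩
  refine ⟨hmild, ?_⟩
  have hTm : T ∈ Icc 0 T := right_mem_Icc.2 hT.le
  have hL2 : ∀ u ∈ OptimalControl.admissibleControls T U,
      MemLp u 2 (volume.restrict (Icc 0 T)) := fun u hu =>
    MemLp.of_bound (Lp.aestronglyMeasurable u) R (hbd u hu)
  have hmk : ∀ v : ℝ → EuclideanSpace ℝ (Fin m),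
      AEStronglyMeasurable v (volume.restrict (Icc 0 T)) →
      (∀ᵐ t ∂(volume.restrict (Icc 0 T)), v t ∈ U) →
      ∃ u ∈ OptimalControl.admissibleControls T U, u =ᵐ[volume.restrict (Icc 0 T)] v := by
    intro v hv hvU
    have hvL : MemLp v ∞ (volume.restrict (Icc 0 T)) :=
      MemLp.of_bound hv R (hvU.mono fun t ht => hUR _ ht)
    refine ⟨hvL.toLp v, ?_, hvL.coeFn_toLp⟩
    change ∀ᵐ t ∂_, _
    filter_upwards [hvL.coeFn_toLp, hvU] with t h1 h2
    rwa [h1]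
  choose x hx using fun u : OptimalControl.admissibleControls T U => hmild u u.2
  obtain ⟨p, hp⟩ := hU_nonempty
  obtain ⟨u₀, hu₀, -⟩ := hmk (fun _ => p) aestronglyMeasurable_const (Eventually.of_forall fun _ => hp)
  have : Nonempty (OptimalControl.admissibleControls T U) := ⟨⟨u₀, hu₀⟩⟩
  obtain ⟨s, hs⟩ := OptimalControl.exists_minimizing_seq
    fun u : OptimalControl.admissibleControls T U => OptimalControl.cost T α ℓ u.1 (x u)
  obtain ⟨v, hvm, hvU, φ, hφ, hlim⟩ := OptimalControl.exists_subseq_tendsto_integral_inner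
    hU_compact hU_convex (fun n => Lp.aestronglyMeasurable (s n).1) (fun n => (s n).2)
  obtain ⟨u, hu, huv⟩ := hmk v hvm hvU
  have hweak : ∀ ψ : ℝ → EuclideanSpace ℝ (Fin m), MemLp ψ 2 (volume.restrict (Icc 0 T)) →
      Tendsto (fun n => ∫ t in Icc 0 T, ⟪ψ t, (s (φ n)).1 t⟫) atTop
        (𝓝 (∫ t in Icc 0 T, ⟪ψ t, u t⟫)) := by
    intro ψ hψ
    rw [integral_congr_ae (g := fun t => ⟪ψ t, v t⟫) (huv.mono fun t ht => by simp only [ht])]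
    exact hlim ψ hψ
  refine ⟨u, hu, x ⟨u, hu⟩, (hx ⟨u, hu⟩).1, fun w hw y hy => ?_⟩
  -- By uniqueness the cost does not depend on which trajectory is chosen.
  have hcost : OptimalControl.cost T α ℓ w y = OptimalControl.cost T α ℓ w (x ⟨w, hw⟩) := by
    rw [OptimalControl.cost, OptimalControl.cost, (hx ⟨w, hw⟩).2 y hy hTm]
  rw [hcost]
  by_contra! hlt
  have hstate := OptimalControl.tendsto_final_state hS hT.le hR hf hG hGgh
    (fun n => Lp.aestronglyMeasurable (s (φ n)).1) (fun n => hbd _ (s (φ n)).2)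
    (Lp.aestronglyMeasurable u) (hbd u hu) hweak (fun n => (hx (s (φ n))).1) (hx ⟨u, hu⟩).1
  -- If `w` beats `u` by ε, then for some large n the cost of the n-th control is below cost(w) +
  -- ε/3. Losing ε/3 in `ℓ` and ε/3 in the quadratic term, it also exceeds cost(u) - 2ε/3, which is
  -- the same number.
  set ε := OptimalControl.cost T α ℓ u (x ⟨u, hu⟩) - OptimalControl.cost T α ℓ w (x ⟨w, hw⟩)
    with hε
  have hε0 : 0 < ε := sub_pos.2 hlt
  have hev1 := hφ.tendsto_atTop.eventually
    (hs ⟨w, hw⟩ (OptimalControl.cost T α ℓ w (x ⟨w, hw⟩) + ε / 3) (by linarith))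
  have hev2 := hstate.eventually (hℓ (x ⟨u, hu⟩ T) (ℓ (x ⟨u, hu⟩ T) - ε / 3) (by linarith))
  have hself : ∫ t in Icc 0 T, ⟪u t, u t⟫ = ∫ t in Icc 0 T, ‖u t‖ ^ 2 := by
    simp only [real_inner_self_eq_norm_sq]
  have hquad := (((hweak u (hL2 u hu)).const_mul 2).sub_const
    (∫ t in Icc 0 T, ‖u t‖ ^ 2)).const_mul (α / 2)
  rw [hself] at hquad
  have hev3 := hquad.eventually (lt_mem_nhds (a := α / 2 * (∫ t in Icc 0 T, ‖u t‖ ^ 2) - ε / 3)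
    (by linarith))
  obtain ⟨n, h1, h2, h3⟩ := (hev1.and (hev2.and hev3)).exists
  have h4 := mul_le_mul_of_nonneg_left
    (OptimalControl.two_mul_integral_inner_sub_le (hL2 _ (s (φ n)).2) (hL2 u hu))
    (by positivity : 0 ≤ α / 2)
  simp only [OptimalControl.cost] at h1 hε
  linarith
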